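/- For a real random variable $\xi$ let $\|\xi\|_{\psi_2}=\inf\{s>0:\ \mathbb{E}\exp(\xi^2/s^2)\le 2\}$ denote its subgaussian norm ($\inf\emptyset=\infty$); $\xi$ is subgaussian if $\|\xi\|_{\psi_2}<\infty$. For every $K\ge 0$ there is a constant $c>0$, depending only on $K$, such that the following holds. Let $n$ and $d$ be positive integers and let $L\subset\mathbb{R}^{n^d}$ be a linear subspace of codimension $k$. Let $x_1,\dots,x_d$ be independent random vectors in $\mathbb{R}^n$ such that the coordinates of each $x_j$ are independent random variables with mean zero, unit variance and subgaussian norm at most $K$. Let $X=x_1\otimes\cdots\otimes x_d\in\mathbb{R}^{n^d}$ be the tensor with entries $X_{i_1\dots i_d}=(x_1)_{i_1}\cdots(x_d)_{i_d}$. Then, for every $0\le t\le 2\sqrt{k}$, $$\mathbb{P}\big\{\,|\mathrm{dist}(X,L)-\sqrt{k}\,|\ge t\,\big\}\ \le\ 2\exp\Big(-\frac{c\,t^2}{d\,n^{d-1}}\Big),$$ where $\mathrm{dist}$ is the Euclidean distance in $\mathbb{R}^{n^d}$. -/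

import Mathlib

open MeasureTheory ProbabilityTheory
open scoped NNReal ENNReal

/-- The subgaussian norm `‖ξ‖_{ψ₂} = inf {s > 0 : E exp (ξ² / s²) ≤ 2}` of a real random variable,
with value `∞` when there is no such `s`, that is, when `ξ` is not subgaussian. -/
noncomputable def psiTwoNorm {Ω : Type*} [MeasurableSpace Ω] (ξ : Ω → ℝ) (μ : Measure Ω) : ℝ≥0∞ :=
  ⨅ (s : ℝ) (_ : 0 < s)
    (_ : ∫⁻ ω, ENNReal.ofReal (Real.exp (ξ ω ^ 2 / s ^ 2)) ∂μ ≤ 2), ENNReal.ofReal s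

/-- The simple tensor `x₁ ⊗ ⋯ ⊗ x_d` as an element of `ℝ^{n^d}`, the Euclidean space of
arrays `(i₁, …, i_d) ↦ X_{i₁ … i_d}`: its entries are `(x₁)_{i₁} ⋯ (x_d)_{i_d}`. -/
noncomputable def simpleTensor {n d : ℕ} (x : Fin d → EuclideanSpace ℝ (Fin n)) :
    EuclideanSpace ℝ (Fin d → Fin n) :=
  WithLp.toLp 2 fun i => ∏ k, x k (i k)

/-! The distance is `‖P X‖` with `P` the orthogonal projection onto `Lᗮ`, so it suffices to control
`‖P X‖ ^ 2 - k` at scale `t * √k`. Write `m I` for the image of the basis tensor `I`. Contracting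
`m` with one random factor gives a linear map on tensors of one order less; its squared
Hilbert–Schmidt norm `T` is a quadratic form in that factor with mean the old `T`. Starting from `T
= k` and contracting every factor, `T` ends at `‖P X‖ ^ 2`.

Each increment is controlled by a Hanson–Wright bound (`lintegral_ennexp_quadratic_le`), which needs
`T` and the operator norm of the current map not to be too large. The operator norm grows at most by
the product of the `‖x_j‖ ^ 2 / n`, and `y ≤ exp (y - 1)` turns this product into a sum of centred
terms, recorded by `N`. `pi_tensorEval_tail_le` carries both by induction on the order: its bound
has one exponential for each sign of `T - k` and one for `N`. Once `T` or `N` leaves its allowed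
range, the bound already exceeds 1, so neither a maximal inequality nor a stopping time is needed.

The Hanson–Wright bound follows from splitting off the diagonal, decoupling by random bipartitions,
and Gaussian linearization of `exp (s * ‖·‖ ^ 2)`. -/

/-- The exponential of a real number, as an extended nonnegative real. -/
noncomputable def ennexp (r : ℝ) : ℝ≥0∞ := ENNReal.ofReal (Real.exp r)

lemma ennexp_add (r s : ℝ) : ennexp (r + s) = ennexp r * ennexp s := by
  simp only [ennexp, Real.exp_add, ENNReal.ofReal_mul (Real.exp_pos r).le]

lemma ennexp_zero : ennexp 0 = 1 := by simp [ennexp]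

lemma ennexp_mono {r s : ℝ} (h : r ≤ s) : ennexp r ≤ ennexp s :=
  ENNReal.ofReal_le_ofReal (Real.exp_le_exp.2 h)

lemma ennexp_ne_top (r : ℝ) : ennexp r ≠ ∞ := ENNReal.ofReal_ne_top

lemma one_le_ennexp {r : ℝ} (h : 0 ≤ r) : 1 ≤ ennexp r := by
  rw [← ennexp_zero]; exact ennexp_mono h

lemma ennexp_sum {ι : Type*} (s : Finset ι) (f : ι → ℝ) :
    ennexp (∑ i ∈ s, f i) = ∏ i ∈ s, ennexp (f i) := by
  simp only [ennexp, Real.exp_sum]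
  exact ENNReal.ofReal_prod_of_nonneg fun i _ => (Real.exp_pos _).le

@[fun_prop]
lemma continuous_ennexp : Continuous ennexp := ENNReal.continuous_ofReal.comp Real.continuous_exp

@[fun_prop]
lemma measurable_ennexp : Measurable ennexp := continuous_ennexp.measurable

lemma two_mul_ennexp_add_le (p q : ℝ) : 2 * ennexp (p + q) ≤ ennexp (2 * p) + ennexp (2 * q) := by
  have h : (2 : ℝ≥0∞) = ENNReal.ofReal 2 := by simp
  rw [h, ennexp, ennexp, ennexp, ← ENNReal.ofReal_mul (by norm_num),
    ← ENNReal.ofReal_add (Real.exp_pos _).le (Real.exp_pos _).le]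
  apply ENNReal.ofReal_le_ofReal
  rw [two_mul p, two_mul q, Real.exp_add, Real.exp_add, Real.exp_add]
  nlinarith [sq_nonneg (Real.exp p - Real.exp q)]

/-- Jensen's inequality for the uniform average of exponentials. -/
lemma card_mul_ennexp_le_sum {ι : Type*} [Fintype ι] [Nonempty ι] (f : ι → ℝ) :
    (Fintype.card ι : ℝ≥0∞) * ennexp ((∑ i, f i) / Fintype.card ι) ≤ ∑ i, ennexp (f i) := by
  have hc : (0 : ℝ) < Fintype.card ι := by exact_mod_cast Fintype.card_pos
  have key := convexOn_exp.map_sum_le (t := (Finset.univ : Finset ι))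
    (w := fun _ => (Fintype.card ι : ℝ)⁻¹) (p := f) (fun _ _ => by positivity)
    (by simp [hc.ne']) (by simp)
  simp only [smul_eq_mul, ← Finset.mul_sum] at key
  simp only [ennexp]
  rw [← ENNReal.ofReal_sum_of_nonneg (fun i _ => (Real.exp_pos _).le),
    ← ENNReal.ofReal_natCast, ← ENNReal.ofReal_mul (by positivity)]
  apply ENNReal.ofReal_le_ofReal
  rw [div_eq_inv_mul]
  calc _ ≤ (Fintype.card ι : ℝ) * ((Fintype.card ι : ℝ)⁻¹ * ∑ i, Real.exp (f i)) := by gcongr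
    _ = _ := by field_simp

/-! ### Scalar exponential moments -/

/-- Exponential moment bounds, with parameter `a`, for a standardized subgaussian law. -/
structure HasExpMomentBounds (a : ℝ) (ν : Measure ℝ) : Prop where
  linear : ∀ y : ℝ, ∫⁻ x, ennexp (y * x) ∂ν ≤ ennexp (a * y ^ 2)
  square : ∀ r : ℝ, |r| * a ≤ 1 → ∫⁻ x, ennexp (r * (x ^ 2 - 1)) ∂ν ≤ ennexp (a * r ^ 2)

lemma lintegral_ennexp_le_of_le {α : Type*} [MeasurableSpace α] {ν : Measure α} {f g : α → ℝ}
    {B : ℝ} (hfg : ∀ x, Real.exp (f x) ≤ g x) (hg : Integrable g ν) (hB : ∫ x, g x ∂ν ≤ Real.exp B) :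
    ∫⁻ x, ennexp (f x) ∂ν ≤ ennexp B := by
  calc ∫⁻ x, ennexp (f x) ∂ν ≤ ∫⁻ x, ENNReal.ofReal (g x) ∂ν :=
        lintegral_mono fun x => ENNReal.ofReal_le_ofReal (hfg x)
    _ = ENNReal.ofReal (∫ x, g x ∂ν) :=
        (ofReal_integral_eq_lintegral_ofReal hg
          (ae_of_all _ fun x => (Real.exp_pos _).le.trans (hfg x))).symm
    _ ≤ _ := ENNReal.ofReal_le_ofReal hB

/-- Integrating this kills the linear term of a centred variable and leaves only the exponential of
the square. -/
lemma exp_le_add_exp_sq (x : ℝ) : Real.exp x ≤ x + Real.exp (x ^ 2) := by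
  rcases le_or_gt |x| 1 with h | h
  · have h1 := (abs_le.1 (Real.abs_exp_sub_one_sub_id_le h)).2
    have h2 := Real.add_one_le_exp (x ^ 2)
    linarith
  · rcases le_or_gt 0 x with h0 | h0
    · rw [abs_of_nonneg h0] at h
      have : Real.exp x ≤ Real.exp (x ^ 2) := Real.exp_le_exp.2 (by nlinarith)
      linarith
    · rw [abs_of_neg h0] at h
      have h1 : Real.exp x ≤ 1 := Real.exp_le_one_iff.2 h0.le
      have h2 := Real.add_one_le_exp (x ^ 2)
      nlinarith

lemma exp_le_one_add_add_sq_mul (z : ℝ) : Real.exp z ≤ 1 + z + z ^ 2 * Real.exp |z| := by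
  have h := Complex.norm_exp_sub_sum_le_norm_mul_exp (z : ℂ) 2
  simp only [Finset.sum_range_succ, Finset.sum_range_zero, pow_zero, Nat.factorial, pow_one,
    Nat.cast_one, div_one, zero_add, mul_one] at h
  have e : Complex.exp z - (1 + z) = ((Real.exp z - (1 + z) : ℝ) : ℂ) := by push_cast; rfl
  rw [e, Complex.norm_real, Complex.norm_real, Real.norm_eq_abs, Real.norm_eq_abs, sq_abs] at h
  linarith [le_abs_self (Real.exp z - (1 + z))]

lemma exp_mul_le_of_mem_Icc {p z : ℝ} (h0 : 0 ≤ p) (h1 : p ≤ 1) :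
    Real.exp (p * z) ≤ 1 - p + p * Real.exp z := by
  have := convexOn_exp.2 (Set.mem_univ (0 : ℝ)) (Set.mem_univ z) (sub_nonneg.2 h1) h0 (by ring)
  simpa using this

lemma HasExpMomentBounds.of_integral {s : ℝ} (hs : 1 ≤ s) {ν : Measure ℝ} [IsProbabilityMeasure ν]
    (h1 : ∫ x, x ∂ν = 0) (h2 : ∫ x, x ^ 2 ∂ν = 1)
    (hexp : ∫⁻ x, ENNReal.ofReal (Real.exp (x ^ 2 / s ^ 2)) ∂ν ≤ 2) :
    HasExpMomentBounds (48 * s ^ 4) ν := by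
  have s0 : 0 < s := by linarith
  have hF : Integrable (fun x : ℝ => Real.exp (x ^ 2 / s ^ 2)) ν := by
    refine ⟨by fun_prop, ?_⟩
    rw [hasFiniteIntegral_iff_ofReal (ae_of_all _ fun x => (Real.exp_pos _).le)]
    exact hexp.trans_lt (by simp)
  have hF2 : ∫ x, Real.exp (x ^ 2 / s ^ 2) ∂ν ≤ 2 := by
    rw [integral_eq_lintegral_of_nonneg_ae (ae_of_all _ fun x => (Real.exp_pos _).le) (by fun_prop)]
    exact ENNReal.toReal_le_of_le_ofReal (by norm_num) (by simpa using hexp)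
  have hsq : Integrable (fun x : ℝ => x ^ 2) ν := by
    refine (hF.const_mul (s ^ 2)).mono' (by fun_prop) (ae_of_all _ fun x => ?_)
    have := Real.add_one_le_exp (x ^ 2 / s ^ 2)
    rw [Real.norm_eq_abs, abs_of_nonneg (sq_nonneg x)]
    calc x ^ 2 = s ^ 2 * (x ^ 2 / s ^ 2) := by field_simp
      _ ≤ _ := by gcongr; linarith
  have hid : Integrable (fun x : ℝ => x) ν := by
    refine ((integrable_const 1).add hsq).mono' (by fun_prop) (ae_of_all _ fun x => ?_)
    simp only [Pi.add_apply, Real.norm_eq_abs]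
    nlinarith [sq_nonneg (|x| - 1), sq_abs x]
  have s4 : s ^ 2 ≤ s ^ 4 := pow_le_pow_right₀ hs (by norm_num)
  have s2 : 1 ≤ s ^ 2 := one_le_pow₀ hs
  constructor
  · intro y
    refine le_trans ?_ (ennexp_mono (r := s ^ 2 * y ^ 2) (by gcongr; linarith))
    set p := s ^ 2 * y ^ 2 with hp
    have p0 : 0 ≤ p := by positivity
    -- For `p ≤ 1`, centring and convexity in the exponent give `1 + p`. For `p > 1`, centring is
    -- not needed: `y * x ≤ p / 2 + x ^ 2 / (2 * s ^ 2)`, and `3 / 2 ≤ 1 + p / 2 ≤ exp (p / 2)`.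
    rcases le_or_gt p 1 with hp1 | hp1
    · refine lintegral_ennexp_le_of_le
        (g := fun x => y * x + ((1 - p) + p * Real.exp (x ^ 2 / s ^ 2))) (fun x => ?_)
        ((hid.const_mul y).add ((integrable_const _).add (hF.const_mul p))) ?_
      · refine (exp_le_add_exp_sq _).trans ?_
        have : (y * x) ^ 2 = p * (x ^ 2 / s ^ 2) := by rw [hp]; field_simp
        rw [this]
        gcongr
        exact exp_mul_le_of_mem_Icc p0 hp1
      · have i1 : Integrable (fun x : ℝ => 1 - p + p * Real.exp (x ^ 2 / s ^ 2)) ν :=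
          (integrable_const _).add (hF.const_mul p)
        rw [integral_add (hid.const_mul y) i1,
          integral_add (integrable_const _) (hF.const_mul p), integral_const_mul,
          integral_const_mul, h1]
        simp only [integral_const, probReal_univ, smul_eq_mul, one_mul, mul_zero, zero_add]
        nlinarith [Real.add_one_le_exp p]
    · refine lintegral_ennexp_le_of_le
        (g := fun x => Real.exp (p / 2) * (1 / 2 + 1 / 2 * Real.exp (x ^ 2 / s ^ 2))) (fun x => ?_)
        (((integrable_const _).add (hF.const_mul _)).const_mul _) ?_
      · have h : y * x ≤ p / 2 + 1 / 2 * (x ^ 2 / s ^ 2) := by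
          have e : p / 2 + 1 / 2 * (x ^ 2 / s ^ 2) - y * x = (s * y - x / s) ^ 2 / 2 := by
            rw [hp]; field_simp; ring
          nlinarith [sq_nonneg (s * y - x / s)]
        refine (Real.exp_le_exp.2 h).trans ?_
        rw [Real.exp_add]
        gcongr
        have := exp_mul_le_of_mem_Icc (p := 1 / 2) (z := x ^ 2 / s ^ 2) (by norm_num) (by norm_num)
        linarith
      · rw [integral_const_mul, integral_add (integrable_const _) (hF.const_mul _),
          integral_const_mul]
        simp only [integral_const, probReal_univ, smul_eq_mul, one_mul]
        have e : Real.exp p = Real.exp (p / 2) * Real.exp (p / 2) := by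
          rw [← Real.exp_add]; ring_nf
        rw [e]
        have := Real.add_one_le_exp (p / 2)
        gcongr
        linarith
  · intro r hr
    have hr' : |r| ≤ 1 / (2 * s ^ 2) := by
      rw [le_div_iff₀ (by positivity)]
      nlinarith [abs_nonneg r]
    -- Second-order Taylor bound: unit variance makes the linear term integrate to 0, and smallness
    -- of `r` lets `exp (x ^ 2 / s ^ 2)` absorb the remainder.
    refine lintegral_ennexp_le_of_le
      (g := fun x => 1 + (r * (x ^ 2 - 1) + 24 * s ^ 4 * r ^ 2 * Real.exp (x ^ 2 / s ^ 2)))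
      (fun x => ?_) ((integrable_const _).add (((hsq.sub (integrable_const 1)).const_mul r).add
        (hF.const_mul _))) ?_
    · refine (exp_le_one_add_add_sq_mul _).trans ?_
      rw [add_assoc]
      refine add_le_add le_rfl (add_le_add le_rfl ?_)
      set w := |x ^ 2 - 1| with hw
      have w0 : 0 ≤ w := abs_nonneg _
      have hw1 : w ≤ x ^ 2 + 1 := by rw [hw, abs_le]; constructor <;> nlinarith [sq_nonneg x]
      rw [abs_mul, mul_pow, ← sq_abs (x ^ 2 - 1), ← hw]
      set q := w / (2 * s ^ 2) with hq
      have q0 : 0 ≤ q := by positivity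
      have hwq : w ^ 2 ≤ 8 * s ^ 4 * Real.exp q := by
        have e : w ^ 2 = 4 * s ^ 4 * q ^ 2 := by rw [hq]; field_simp; ring
        have := Real.quadratic_le_exp_of_nonneg q0
        rw [e]
        have : q ^ 2 ≤ 2 * Real.exp q := by linarith
        nlinarith [pow_pos s0 4]
      have hrq : |r| * w ≤ q := by
        calc |r| * w ≤ 1 / (2 * s ^ 2) * w := by gcongr
          _ = q := by rw [hq]; ring
      have h2q : Real.exp q * Real.exp q ≤ 3 * Real.exp (x ^ 2 / s ^ 2) := by
        rw [← Real.exp_add]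
        have : q + q ≤ 1 + x ^ 2 / s ^ 2 := by
          calc q + q = w / s ^ 2 := by rw [hq]; field_simp; ring
            _ ≤ (x ^ 2 + 1) / s ^ 2 := by gcongr
            _ = 1 / s ^ 2 + x ^ 2 / s ^ 2 := by ring
            _ ≤ _ := by gcongr; rw [div_le_one (by positivity)]; exact s2
        refine (Real.exp_le_exp.2 this).trans ?_
        rw [Real.exp_add]
        gcongr
        linarith [Real.exp_one_lt_d9]
      calc r ^ 2 * w ^ 2 * Real.exp (|r| * w)
          ≤ r ^ 2 * (8 * s ^ 4 * Real.exp q) * Real.exp q := by gcongr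
        _ = 8 * s ^ 4 * r ^ 2 * (Real.exp q * Real.exp q) := by ring
        _ ≤ 8 * s ^ 4 * r ^ 2 * (3 * Real.exp (x ^ 2 / s ^ 2)) := by gcongr
        _ = _ := by ring
    · have i1 : Integrable (fun x : ℝ => r * (x ^ 2 - 1)) ν :=
        (hsq.sub (integrable_const 1)).const_mul r
      have i2 : Integrable (fun x : ℝ => r * (x ^ 2 - 1) +
          24 * s ^ 4 * r ^ 2 * Real.exp (x ^ 2 / s ^ 2)) ν := i1.add (hF.const_mul _)
      rw [integral_add (integrable_const _) i2,
        integral_add i1 (hF.const_mul _), integral_const_mul, integral_const_mul,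
        integral_sub hsq (integrable_const 1), h2]
      simp only [integral_const, probReal_univ, smul_eq_mul, mul_one, sub_self, mul_zero, zero_add]
      have := Real.add_one_le_exp (48 * s ^ 4 * r ^ 2)
      have : 24 * s ^ 4 * r ^ 2 * ∫ x, Real.exp (x ^ 2 / s ^ 2) ∂ν ≤ 24 * s ^ 4 * r ^ 2 * 2 := by
        gcongr
      linarith

lemma lintegral_ennexp_mul_gaussianReal (y : ℝ) :
    ∫⁻ g, ennexp (y * g) ∂gaussianReal 0 1 = ennexp (y ^ 2 / 2) := by
  have h := congrFun (mgf_fun_id_gaussianReal (μ := 0) (v := 1)) y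
  rw [mgf] at h
  simp only [ennexp]
  rw [← ofReal_integral_eq_lintegral_ofReal (integrable_exp_mul_gaussianReal y)
    (ae_of_all _ fun x => (Real.exp_pos _).le), h]
  simp

lemma lintegral_ennexp_mul_sq_gaussianReal_le {c : ℝ} (h0 : 0 ≤ c) (h1 : c ≤ 1 / 4) :
    ∫⁻ g, ennexp (c * g ^ 2) ∂gaussianReal 0 1 ≤ ennexp (2 * c) := by
  rw [gaussianReal_of_var_ne_zero _ one_ne_zero,
    lintegral_withDensity_eq_lintegral_mul _ (measurable_gaussianPDF _ _) (by fun_prop)]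
  have e : ∀ g : ℝ, (gaussianPDF 0 1 * fun g => ennexp (c * g ^ 2)) g
      = ENNReal.ofReal ((√(2 * Real.pi))⁻¹ * Real.exp (-(1 / 2 - c) * g ^ 2)) := by
    intro g
    simp only [Pi.mul_apply, gaussianPDF, gaussianPDFReal, ennexp]
    rw [← ENNReal.ofReal_mul (by positivity), mul_assoc, ← Real.exp_add]
    congr 3
    · simp
    · simp; ring
  have hc : 0 < 1 / 2 - c := by linarith
  simp only [e]
  rw [← ofReal_integral_eq_lintegral_ofReal ((integrable_exp_neg_mul_sq hc).const_mul _)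
    (ae_of_all _ fun x => by positivity), integral_const_mul, integral_gaussian]
  apply ENNReal.ofReal_le_ofReal
  rw [inv_mul_le_iff₀ (by positivity)]
  apply Real.sqrt_le_iff.2 ⟨by positivity, ?_⟩
  rw [mul_pow, Real.sq_sqrt (by positivity), div_le_iff₀ hc, ← Real.exp_nat_mul]
  have := Real.add_one_le_exp ((2 : ℕ) * (2 * c))
  push_cast at this ⊢
  -- Here `(1 + 4 * c) * (1 - 2 * c) ≥ 1` is exactly where `c ≤ 1 / 4` enters.
  have h3 : 1 ≤ Real.exp (2 * (2 * c)) * (1 - 2 * c) := by nlinarith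
  nlinarith [Real.pi_pos]

/-! ### Gram matrices and operator bounds -/

section Gram

variable {ι H : Type*} [Fintype ι] [NormedAddCommGroup H] [InnerProductSpace ℝ H]

lemma norm_sq_sum_smul_eq (m : ι → H) (x : ι → ℝ) :
    ‖∑ i, x i • m i‖ ^ 2 = ∑ i, ∑ j, x i * x j * inner ℝ (m i) (m j) := by
  rw [← real_inner_self_eq_norm_sq, sum_inner]
  refine Finset.sum_congr rfl fun i _ => ?_
  rw [inner_sum]
  refine Finset.sum_congr rfl fun j _ => ?_
  rw [real_inner_smul_left, real_inner_smul_right]; ring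

/-- Singular value decomposition of `x ↦ ∑ i, x i • m i`. -/
lemma exists_orthonormalBasis_norm_sq_sum_smul (m : ι → H) :
    ∃ (e : OrthonormalBasis ι ℝ (EuclideanSpace ℝ ι)) (d : ι → ℝ),
      (∀ k, d k = ‖∑ i, e k i • m i‖ ^ 2) ∧
      ∀ x : ι → ℝ, ‖∑ i, x i • m i‖ ^ 2 = ∑ k, d k * (∑ i, e k i * x i) ^ 2 := by
  classical
  let G : Matrix ι ι ℝ := Matrix.of fun i j => inner ℝ (m i) (m j)
  have hG : G.IsHermitian := by
    ext i j; simp [G, real_inner_comm]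
  have key : ∀ x : ι → ℝ, ‖∑ i, x i • m i‖ ^ 2 =
      ∑ k, hG.eigenvalues k * (∑ i, hG.eigenvectorBasis k i * x i) ^ 2 := by
    intro x
    have hx : ‖∑ i, x i • m i‖ ^ 2 =
        inner ℝ (WithLp.toLp 2 x) (WithLp.toLp 2 (G.mulVec x) : EuclideanSpace ℝ ι) := by
      rw [norm_sq_sum_smul_eq]
      simp only [PiLp.inner_apply, Matrix.mulVec, dotProduct, G, Matrix.of_apply, RCLike.inner_apply,
        conj_trivial, Finset.sum_mul]
      refine Finset.sum_congr rfl fun i _ => Finset.sum_congr rfl fun j _ => by ring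
    rw [hx, ← hG.eigenvectorBasis.sum_inner_mul_inner]
    refine Finset.sum_congr rfl fun k _ => ?_
    have h1 : inner ℝ (WithLp.toLp 2 x) (hG.eigenvectorBasis k)
        = ∑ i, hG.eigenvectorBasis k i * x i := by
      simp [PiLp.inner_apply]
    have h2 : inner ℝ (hG.eigenvectorBasis k) (WithLp.toLp 2 (G.mulVec x) : EuclideanSpace ℝ ι)
        = hG.eigenvalues k * ∑ i, hG.eigenvectorBasis k i * x i := by
      have h3 : inner ℝ (hG.eigenvectorBasis k) (WithLp.toLp 2 (G.mulVec x) : EuclideanSpace ℝ ι)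
          = (hG.eigenvectorBasis k : ι → ℝ) ⬝ᵥ G.mulVec x := by
        simp [PiLp.inner_apply, dotProduct, mul_comm]
      rw [h3, Matrix.dotProduct_mulVec, ← Matrix.mulVec_transpose]
      have : G.transpose = G := by simpa using hG.eq
      rw [this, hG.mulVec_eigenvectorBasis, smul_dotProduct]
      simp [dotProduct]
    rw [h1, h2]; ring
  refine ⟨hG.eigenvectorBasis, hG.eigenvalues, fun k => ?_, key⟩
  rw [key]
  have h : ∀ l, ∑ i, hG.eigenvectorBasis l i * hG.eigenvectorBasis k i
      = if k = l then 1 else 0 := by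
    intro l
    rw [← orthonormal_iff_ite.1 hG.eigenvectorBasis.orthonormal k l]
    simp [PiLp.inner_apply]
  simp [h]

/-- The operator bound passes to the adjoint: test it on the coefficients `inner ℝ (m i) w`, apply
Cauchy–Schwarz, and cancel one factor `S`. -/
lemma sum_inner_sq_le {m : ι → H} {b : ℝ} (hb0 : 0 ≤ b)
    (hb : ∀ x : ι → ℝ, ‖∑ i, x i • m i‖ ^ 2 ≤ b * ∑ i, x i ^ 2)
    (w : H) : ∑ i, inner ℝ (m i) w ^ 2 ≤ b * ‖w‖ ^ 2 := by
  set S := ∑ i, inner ℝ (m i) w ^ 2 with hS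
  have S0 : 0 ≤ S := Finset.sum_nonneg fun i _ => sq_nonneg _
  have h1 : S = inner ℝ (∑ i, (inner ℝ (m i) w) • m i) w := by
    rw [sum_inner, hS]
    refine Finset.sum_congr rfl fun i _ => ?_
    rw [real_inner_smul_left]; ring
  have h2 : S ^ 2 ≤ (b * S) * ‖w‖ ^ 2 := by
    calc S ^ 2 ≤ (‖∑ i, (inner ℝ (m i) w) • m i‖ * ‖w‖) ^ 2 := by
          gcongr
          rw [h1]; exact real_inner_le_norm _ _
      _ = ‖∑ i, (inner ℝ (m i) w) • m i‖ ^ 2 * ‖w‖ ^ 2 := by ring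
      _ ≤ _ := by gcongr; exact hb _
  rcases S0.eq_or_lt with h | h
  · rw [← h]; positivity
  · nlinarith

lemma norm_sq_le_of_norm_sq_sum_le {m : ι → H} {b : ℝ}
    (hb : ∀ x : ι → ℝ, ‖∑ i, x i • m i‖ ^ 2 ≤ b * ∑ i, x i ^ 2) (i : ι) : ‖m i‖ ^ 2 ≤ b := by
  classical
  simpa [Pi.single_apply] using hb (Pi.single i 1)

end Gram

/-! ### Exponential moments under product measures -/

section MomentBounds

variable {ι κ H : Type*} [Fintype ι] [Fintype κ] [NormedAddCommGroup H] [InnerProductSpace ℝ H]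

lemma lintegral_pi_prod (ν : ι → Measure ℝ) [∀ i, IsProbabilityMeasure (ν i)]
    {f : ι → ℝ → ℝ≥0∞} (hf : ∀ i, Measurable (f i)) :
    ∫⁻ x, ∏ i, f i (x i) ∂Measure.pi ν = ∏ i, ∫⁻ y, f i y ∂ν i := by
  rw [lintegral_prod_eq_prod_lintegral_of_indepFun Finset.univ (fun i (x : ι → ℝ) => f i (x i))
    (iIndepFun_pi fun i => (hf i).aemeasurable) (fun i => (hf i).comp (measurable_pi_apply i))]
  exact Finset.prod_congr rfl fun i _ => (measurePreserving_eval ν i).lintegral_comp (hf i)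

lemma lintegral_ennexp_sum_le (ν : ι → Measure ℝ) [∀ i, IsProbabilityMeasure (ν i)]
    {f : ι → ℝ → ℝ} (hf : ∀ i, Measurable (f i)) {B : ι → ℝ}
    (hB : ∀ i, ∫⁻ y, ennexp (f i y) ∂ν i ≤ ennexp (B i)) :
    ∫⁻ x, ennexp (∑ i, f i (x i)) ∂Measure.pi ν ≤ ennexp (∑ i, B i) := by
  simp only [ennexp_sum]
  rw [lintegral_pi_prod ν (f := fun i y => ennexp (f i y))
    (fun i => measurable_ennexp.comp (hf i))]
  exact Finset.prod_le_prod' fun i _ => hB i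

lemma lintegral_ennexp_linear_le {a : ℝ} {ν : ι → Measure ℝ} [∀ i, IsProbabilityMeasure (ν i)]
    (hν : ∀ i, HasExpMomentBounds a (ν i)) (y : ι → ℝ) :
    ∫⁻ x, ennexp (∑ i, y i * x i) ∂Measure.pi ν ≤ ennexp (a * ∑ i, y i ^ 2) := by
  rw [Finset.mul_sum]
  exact lintegral_ennexp_sum_le ν (fun i => measurable_const_mul (y i)) fun i => (hν i).linear _

/-- Gaussian linearization: `exp (y ^ 2 / 2)` is the Gaussian average of `exp (y * g)`, applied in
each singular direction. After exchanging integrals the exponent is linear in `x`, and what remains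
is a weighted sum of independent squared Gaussians. -/
lemma lintegral_ennexp_norm_sq_le {a : ℝ} (ha : 0 ≤ a) {ν : ι → Measure ℝ}
    [∀ i, IsProbabilityMeasure (ν i)] (hν : ∀ i, HasExpMomentBounds a (ν i)) {m : ι → H} {b : ℝ}
    (hb : ∀ x : ι → ℝ, ‖∑ i, x i • m i‖ ^ 2 ≤ b * ∑ i, x i ^ 2) {s : ℝ} (hs : 0 ≤ s)
    (hsb : 8 * a * s * b ≤ 1) :
    ∫⁻ x, ennexp (s * ‖∑ i, x i • m i‖ ^ 2) ∂Measure.pi ν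
      ≤ ennexp (4 * a * s * ∑ i, ‖m i‖ ^ 2) := by
  classical
  obtain ⟨e, d, hd, hm⟩ := exists_orthonormalBasis_norm_sq_sum_smul m
  have hnorm : ∀ c : ι → ℝ, ∑ i, (∑ k, c k * e k i) ^ 2 = ∑ k, c k ^ 2 := by
    intro c
    have h := e.orthonormal.inner_sum c c Finset.univ
    rw [real_inner_self_eq_norm_sq, EuclideanSpace.norm_sq_eq] at h
    simpa [sq] using h
  have hnorm1 : ∀ k, ∑ i, e k i ^ 2 = 1 := by
    intro k
    have h := e.orthonormal.1 k
    rw [EuclideanSpace.norm_eq, Real.sqrt_eq_one] at h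
    simpa using h
  have hd0 : ∀ k, 0 ≤ d k := fun k => by rw [hd]; positivity
  have hdb : ∀ k, d k ≤ b := fun k => by
    have := hb (e k)
    rwa [← hd, hnorm1, mul_one] at this
  have htr : ∑ i, ‖m i‖ ^ 2 = ∑ k, d k := by
    have : ∀ i, ‖m i‖ ^ 2 = ∑ k, d k * e k i ^ 2 := fun i => by
      simpa [Pi.single_apply] using hm (Pi.single i 1)
    simp only [this]
    rw [Finset.sum_comm]
    simp [← Finset.mul_sum, hnorm1]
  set γ : Measure (ι → ℝ) := Measure.pi fun _ => gaussianReal 0 1 with hγ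
  have hlin : ∀ x : ι → ℝ, ennexp (s * ‖∑ i, x i • m i‖ ^ 2)
      = ∫⁻ g : ι → ℝ, ennexp (∑ i, (∑ k, √(2 * s * d k) * g k * e k i) * x i) ∂γ := by
    intro x
    have h1 : ∀ g : ι → ℝ, ∑ i, (∑ k, √(2 * s * d k) * g k * e k i) * x i
        = ∑ k, (√(2 * s * d k) * ∑ i, e k i * x i) * g k := by
      intro g
      simp only [Finset.sum_mul, Finset.mul_sum]
      rw [Finset.sum_comm]
      refine Finset.sum_congr rfl fun k _ => Finset.sum_congr rfl fun i _ => by ring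
    simp only [h1, ennexp_sum]
    rw [hγ, lintegral_pi_prod (fun _ => gaussianReal 0 1)
      (f := fun k y => ennexp ((√(2 * s * d k) * ∑ i, e k i * x i) * y)) (fun k => by fun_prop)]
    simp only [lintegral_ennexp_mul_gaussianReal]
    rw [← ennexp_sum, hm, Finset.mul_sum]
    congr 1
    refine Finset.sum_congr rfl fun k _ => ?_
    rw [mul_pow, Real.sq_sqrt (mul_nonneg (by positivity) (hd0 k))]; ring
  simp only [hlin]
  rw [lintegral_lintegral_swap (by fun_prop)]
  calc _ ≤ ∫⁻ g : ι → ℝ, ennexp (∑ k, (2 * a * s * d k) * g k ^ 2) ∂γ := by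
        refine lintegral_mono fun g => (lintegral_ennexp_linear_le hν _).trans ?_
        apply ennexp_mono
        rw [hnorm, Finset.mul_sum]
        refine (Finset.sum_congr rfl fun k _ => ?_).le
        rw [mul_pow, Real.sq_sqrt (mul_nonneg (by positivity) (hd0 k))]; ring
    _ ≤ ennexp (∑ k, 2 * (2 * a * s * d k)) := by
        refine lintegral_ennexp_sum_le (fun _ => gaussianReal 0 1)
          (f := fun k y => (2 * a * s * d k) * y ^ 2) (fun k => by fun_prop) fun k => ?_
        refine lintegral_ennexp_mul_sq_gaussianReal_le
          (mul_nonneg (by positivity) (hd0 k)) ?_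
        have : 8 * a * s * d k ≤ 8 * a * s * b := by gcongr; exact hdb k
        linarith
    _ = _ := by
        rw [htr, Finset.mul_sum]
        congr 1
        refine Finset.sum_congr rfl fun k _ => by ring

/-- For fixed `y` the exponent is linear in `z`; integrating `z` out leaves a multiple of `‖∑ i, y i
• m i‖ ^ 2`. -/
lemma lintegral_ennexp_inner_le {a : ℝ} (ha : 0 ≤ a) {ν : ι → Measure ℝ} {ν' : κ → Measure ℝ}
    [∀ i, IsProbabilityMeasure (ν i)] [∀ j, IsProbabilityMeasure (ν' j)]
    (hν : ∀ i, HasExpMomentBounds a (ν i)) (hν' : ∀ j, HasExpMomentBounds a (ν' j))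
    {m : ι → H} {m' : κ → H} {b : ℝ} (hb0 : 0 ≤ b)
    (hb : ∀ x : ι → ℝ, ‖∑ i, x i • m i‖ ^ 2 ≤ b * ∑ i, x i ^ 2)
    (hb' : ∀ x : κ → ℝ, ‖∑ i, x i • m' i‖ ^ 2 ≤ b * ∑ i, x i ^ 2) {r : ℝ}
    (hr : 8 * a * (a * r ^ 2 * b) * b ≤ 1) :
    ∫⁻ y, ∫⁻ z, ennexp (r * inner ℝ (∑ i, y i • m i) (∑ j, z j • m' j)) ∂Measure.pi ν' ∂Measure.pi ν
      ≤ ennexp (4 * a * (a * r ^ 2 * b) * ∑ i, ‖m i‖ ^ 2) := by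
  refine le_trans (lintegral_mono fun y => ?_)
    (lintegral_ennexp_norm_sq_le ha hν hb (s := a * r ^ 2 * b) (by positivity) hr)
  have h : ∀ z : κ → ℝ, r * inner ℝ (∑ i, y i • m i) (∑ j, z j • m' j)
      = ∑ j, (r * inner ℝ (m' j) (∑ i, y i • m i)) * z j := by
    intro z
    rw [inner_sum, Finset.mul_sum]
    refine Finset.sum_congr rfl fun j _ => ?_
    rw [real_inner_smul_right, real_inner_comm]; ring
  simp only [h]
  refine (lintegral_ennexp_linear_le hν' _).trans (ennexp_mono ?_)
  simp only [mul_pow, ← Finset.mul_sum]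
  have := sum_inner_sq_le hb0 hb' (∑ i, y i • m i)
  calc _ ≤ a * (r ^ 2 * (b * ‖∑ i, y i • m i‖ ^ 2)) := by gcongr
    _ = _ := by ring

end MomentBounds

/-! ### Decoupling and the Hanson–Wright bound -/

section HansonWright

variable {ι H : Type*} [Fintype ι] [NormedAddCommGroup H] [InnerProductSpace ℝ H]

/-- A uniform bipartition separates `i` from `j` in the prescribed order with probability `1 / 4`;
flipping one coordinate at a time shows it. -/
lemma four_mul_sum_bool_eq_card [DecidableEq ι] {i j : ι} (hij : i ≠ j) :
    4 * ∑ δ : ι → Bool, (if δ i then (if δ j then 0 else 1) else 0 : ℝ)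
      = Fintype.card (ι → Bool) := by
  have flip : ∀ (k : ι) (f : (ι → Bool) → ℝ),
      ∑ δ, f (Function.update δ k (!δ k)) = ∑ δ, f δ := by
    intro k f
    have hinv : Function.Involutive fun δ : ι → Bool => Function.update δ k (!δ k) := by
      intro δ; simp
    exact Equiv.sum_comp hinv.toPerm f
  have h1 : 2 * ∑ δ : ι → Bool, (if δ i then (if δ j then 0 else 1) else 0 : ℝ)
      = ∑ δ : ι → Bool, (if δ j then 0 else 1 : ℝ) := by
    rw [two_mul]
    nth_rewrite 2 [← flip i]
    rw [← Finset.sum_add_distrib]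
    refine Finset.sum_congr rfl fun δ _ => ?_
    cases δ i <;> simp [hij.symm]
  have h2 : 2 * ∑ δ : ι → Bool, (if δ j then 0 else 1 : ℝ) = Fintype.card (ι → Bool) := by
    rw [two_mul]
    nth_rewrite 2 [← flip j]
    rw [← Finset.sum_add_distrib, ← Finset.card_univ, Finset.cast_card]
    refine Finset.sum_congr rfl fun δ _ => ?_
    cases h : δ j <;> simp
  linarith

/-- The off-diagonal part of `‖∑ i, u i‖ ^ 2` as an average over random bipartitions. -/
lemma four_mul_sum_inner_bipartition (u : ι → H) [DecidableEq ι] :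
    4 * ∑ δ : ι → Bool, inner ℝ (∑ i, if δ i then u i else 0) (∑ j, if δ j then 0 else u j)
      = Fintype.card (ι → Bool) * (‖∑ i, u i‖ ^ 2 - ∑ i, ‖u i‖ ^ 2) := by
  have h0 : ∀ δ : ι → Bool,
      inner ℝ (∑ i, if δ i then u i else 0) (∑ j, if δ j then 0 else u j)
        = ∑ i, ∑ j, (if δ i then (if δ j then 0 else 1) else 0 : ℝ) * inner ℝ (u i) (u j) := by
    intro δ
    rw [sum_inner]
    refine Finset.sum_congr rfl fun i _ => ?_
    rw [inner_sum]
    refine Finset.sum_congr rfl fun j _ => ?_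
    cases δ i <;> cases δ j <;> simp
  have h1 : ‖∑ i, u i‖ ^ 2 - ∑ i, ‖u i‖ ^ 2
      = ∑ i, ∑ j, if i = j then 0 else inner ℝ (u i) (u j) := by
    rw [← real_inner_self_eq_norm_sq, sum_inner, ← Finset.sum_sub_distrib]
    refine Finset.sum_congr rfl fun i _ => ?_
    have : ‖u i‖ ^ 2 = ∑ j, if i = j then inner ℝ (u i) (u j) else 0 := by simp
    rw [inner_sum, this, ← Finset.sum_sub_distrib]
    refine Finset.sum_congr rfl fun j _ => ?_
    split_ifs <;> simp
  simp only [h0]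
  rw [Finset.sum_comm, h1, Finset.mul_sum, Finset.mul_sum]
  refine Finset.sum_congr rfl fun i _ => ?_
  rw [Finset.sum_comm, Finset.mul_sum, Finset.mul_sum]
  refine Finset.sum_congr rfl fun j _ => ?_
  rw [← Finset.sum_mul, ← mul_assoc]
  split_ifs with hij
  · subst hij
    have : ∀ δ : ι → Bool, (if δ i then (if δ i then 0 else 1) else 0 : ℝ) = 0 := by
      intro δ; cases δ i <;> simp
    simp [this]
  · rw [four_mul_sum_bool_eq_card hij]

lemma norm_sq_sum_subtype_le {m : ι → H} {b : ℝ}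
    (hb : ∀ x : ι → ℝ, ‖∑ i, x i • m i‖ ^ 2 ≤ b * ∑ i, x i ^ 2) (p : ι → Prop) [DecidablePred p]
    (y : {i // p i} → ℝ) :
    ‖∑ i : {i // p i}, y i • m i‖ ^ 2 ≤ b * ∑ i, y i ^ 2 := by
  have h := hb fun i => if h : p i then y ⟨i, h⟩ else 0
  rw [← Fintype.sum_subtype_add_sum_subtype p, ← Fintype.sum_subtype_add_sum_subtype p] at h
  have e1 : ∀ i : {i // p i}, (if h : p i then y ⟨i, h⟩ else 0) = y i := fun i => by simp [i.2]
  have e2 : ∀ i : {i // ¬ p i}, (if h : p i then y ⟨i, h⟩ else 0) = 0 := fun i => by simp [i.2]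
  simpa [e1, e2] using h

/-- The two sides use disjoint sets of coordinates, so they are already independent and no
independent copy of `x` is required. -/
lemma lintegral_ennexp_inner_bipartition_le {a : ℝ} (ha : 0 ≤ a) {ν : ι → Measure ℝ}
    [∀ i, IsProbabilityMeasure (ν i)] (hν : ∀ i, HasExpMomentBounds a (ν i))
    {m : ι → H} {b : ℝ} (hb0 : 0 ≤ b)
    (hb : ∀ x : ι → ℝ, ‖∑ i, x i • m i‖ ^ 2 ≤ b * ∑ i, x i ^ 2) {r : ℝ}
    (hr : 8 * a * (a * r ^ 2 * b) * b ≤ 1) (p : ι → Prop) [DecidablePred p] :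
    ∫⁻ x, ennexp (r * inner ℝ (∑ i, if p i then x i • m i else 0)
        (∑ j, if p j then 0 else x j • m j)) ∂Measure.pi ν
      ≤ ennexp (4 * a * (a * r ^ 2 * b) * ∑ i, ‖m i‖ ^ 2) := by
  have hsum : ∀ x : ι → ℝ, ∑ i, (if p i then x i • m i else 0)
      = ∑ i : {i // p i}, x i • m i := by
    intro x
    rw [← Fintype.sum_subtype_add_sum_subtype p]
    have e1 : ∀ i : {i // p i}, (if p i then x i • m i else 0) = x i • m i :=
      fun i => by simp [i.2]
    have e2 : ∀ i : {i // ¬ p i}, (if p i then x i • m i else 0) = 0 := fun i => by simp [i.2]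
    simp [e1, e2]
  have hsum' : ∀ x : ι → ℝ, ∑ i, (if p i then 0 else x i • m i)
      = ∑ i : {i // ¬ p i}, x i • m i := by
    intro x
    rw [← Fintype.sum_subtype_add_sum_subtype p]
    have e1 : ∀ i : {i // p i}, (if p i then 0 else x i • m i) = 0 := fun i => by simp [i.2]
    have e2 : ∀ i : {i // ¬ p i}, (if p i then 0 else x i • m i) = x i • m i :=
      fun i => by simp [i.2]
    simp [e1, e2]
  simp only [hsum, hsum']
  set F : ({i // p i} → ℝ) × ({i // ¬ p i} → ℝ) → ℝ≥0∞ := fun q =>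
    ennexp (r * inner ℝ (∑ i, q.1 i • m i) (∑ j, q.2 j • m j)) with hF
  have hFm : Measurable F := Continuous.measurable (by fun_prop)
  have h := (measurePreserving_piEquivPiSubtypeProd ν p).lintegral_comp hFm
  rw [lintegral_prod _ hFm.aemeasurable] at h
  refine (h.trans_le ?_)
  refine (lintegral_ennexp_inner_le ha (fun i : {i // p i} => hν i) (fun i : {i // ¬ p i} => hν i)
    hb0 (norm_sq_sum_subtype_le hb p) (norm_sq_sum_subtype_le hb _) hr).trans (ennexp_mono ?_)
  gcongr
  rw [← Fintype.sum_subtype_add_sum_subtype p (fun i => ‖m i‖ ^ 2)]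
  exact le_add_of_nonneg_right (Finset.sum_nonneg fun _ _ => by positivity)

/-- Jensen over all bipartitions moves the average out of the exponential; the separation
probability `1 / 4` turns `r` into `4 * r`. -/
lemma lintegral_ennexp_offDiagonal_le {a : ℝ} (ha : 0 ≤ a) {ν : ι → Measure ℝ}
    [∀ i, IsProbabilityMeasure (ν i)] (hν : ∀ i, HasExpMomentBounds a (ν i))
    {m : ι → H} {b : ℝ} (hb0 : 0 ≤ b)
    (hb : ∀ x : ι → ℝ, ‖∑ i, x i • m i‖ ^ 2 ≤ b * ∑ i, x i ^ 2) {r : ℝ}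
    (hr : 8 * a * (a * (4 * r) ^ 2 * b) * b ≤ 1) :
    ∫⁻ x, ennexp (r * (‖∑ i, x i • m i‖ ^ 2 - ∑ i, ‖x i • m i‖ ^ 2)) ∂Measure.pi ν
      ≤ ennexp (4 * a * (a * (4 * r) ^ 2 * b) * ∑ i, ‖m i‖ ^ 2) := by
  classical
  set N : ℝ≥0∞ := (Fintype.card (ι → Bool) : ℝ≥0∞) with hN
  have hN0 : N ≠ 0 := by simp [hN]
  have hNt : N ≠ ∞ := by simp [hN]
  have hcard : (0 : ℝ) < Fintype.card (ι → Bool) := by exact_mod_cast Fintype.card_pos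
  rw [← ENNReal.mul_le_mul_iff_right hN0 hNt]
  calc N * ∫⁻ x, ennexp (r * (‖∑ i, x i • m i‖ ^ 2 - ∑ i, ‖x i • m i‖ ^ 2)) ∂Measure.pi ν
      = ∫⁻ x, N * ennexp (r * (‖∑ i, x i • m i‖ ^ 2 - ∑ i, ‖x i • m i‖ ^ 2)) ∂Measure.pi ν :=
        (lintegral_const_mul' _ _ hNt).symm
    _ ≤ ∫⁻ x, ∑ δ : ι → Bool, ennexp (4 * r * inner ℝ (∑ i, if δ i then x i • m i else 0)
        (∑ j, if δ j then 0 else x j • m j)) ∂Measure.pi ν := by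
        refine lintegral_mono fun x => ?_
        refine le_trans (le_of_eq ?_) (card_mul_ennexp_le_sum _)
        congr 2
        rw [← Finset.mul_sum, eq_div_iff hcard.ne']
        linear_combination -r * four_mul_sum_inner_bipartition fun i => x i • m i
    _ = ∑ δ : ι → Bool, ∫⁻ x, ennexp (4 * r * inner ℝ (∑ i, if δ i then x i • m i else 0)
        (∑ j, if δ j then 0 else x j • m j)) ∂Measure.pi ν := by
        refine lintegral_finsetSum _ fun δ _ => Continuous.measurable ?_
        refine continuous_ennexp.comp (continuous_const.mul (Continuous.inner ?_ ?_))
        · refine continuous_finsetSum _ fun i _ => ?_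
          split_ifs <;> fun_prop
        · refine continuous_finsetSum _ fun i _ => ?_
          split_ifs <;> fun_prop
    _ ≤ ∑ δ : ι → Bool, ennexp (4 * a * (a * (4 * r) ^ 2 * b) * ∑ i, ‖m i‖ ^ 2) :=
        Finset.sum_le_sum fun δ _ =>
          lintegral_ennexp_inner_bipartition_le ha hν hb0 hb hr fun i => δ i = true
    _ = _ := by rw [Finset.sum_const, nsmul_eq_mul, Finset.card_univ]

lemma lintegral_ennexp_diagonal_le {a : ℝ} (ha : 0 ≤ a) {ν : ι → Measure ℝ}
    [∀ i, IsProbabilityMeasure (ν i)] (hν : ∀ i, HasExpMomentBounds a (ν i))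
    {m : ι → H} {b : ℝ} (hm : ∀ i, ‖m i‖ ^ 2 ≤ b) {r : ℝ} (hr : |r| * b * a ≤ 1) :
    ∫⁻ x, ennexp (r * (∑ i, ‖x i • m i‖ ^ 2 - ∑ i, ‖m i‖ ^ 2)) ∂Measure.pi ν
      ≤ ennexp (a * r ^ 2 * b * ∑ i, ‖m i‖ ^ 2) := by
  have e : ∀ x : ι → ℝ, r * (∑ i, ‖x i • m i‖ ^ 2 - ∑ i, ‖m i‖ ^ 2)
      = ∑ i, (r * ‖m i‖ ^ 2) * (x i ^ 2 - 1) := by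
    intro x
    rw [← Finset.sum_sub_distrib, Finset.mul_sum]
    refine Finset.sum_congr rfl fun i _ => ?_
    rw [norm_smul, mul_pow, Real.norm_eq_abs, sq_abs]; ring
  simp only [e]
  refine (lintegral_ennexp_sum_le ν (f := fun i y => (r * ‖m i‖ ^ 2) * (y ^ 2 - 1))
    (fun i => by fun_prop) fun i => (hν i).square _ ?_).trans (ennexp_mono ?_)
  · rw [abs_mul, abs_of_nonneg (sq_nonneg ‖m i‖)]
    refine le_trans ?_ hr
    gcongr
    exact hm i
  · rw [Finset.mul_sum]
    refine Finset.sum_le_sum fun i _ => ?_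
    calc a * (r * ‖m i‖ ^ 2) ^ 2 = a * r ^ 2 * ‖m i‖ ^ 2 * ‖m i‖ ^ 2 := by ring
      _ ≤ _ := by gcongr; exact hm i

/-- The Hanson–Wright inequality, in exponential moment form, for the positive semidefinite
quadratic form `x ↦ ‖∑ i, x i • m i‖ ^ 2`. -/
lemma lintegral_ennexp_quadratic_le {a : ℝ} (ha : 1 ≤ a) {ν : ι → Measure ℝ}
    [∀ i, IsProbabilityMeasure (ν i)] (hν : ∀ i, HasExpMomentBounds a (ν i))
    {m : ι → H} {b : ℝ} (hb0 : 0 ≤ b)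
    (hb : ∀ x : ι → ℝ, ‖∑ i, x i • m i‖ ^ 2 ≤ b * ∑ i, x i ^ 2) {r : ℝ}
    (hr : |r| * b * (24 * a) ≤ 1) :
    ∫⁻ x, ennexp (r * (‖∑ i, x i • m i‖ ^ 2 - ∑ i, ‖m i‖ ^ 2)) ∂Measure.pi ν
      ≤ ennexp (256 * a ^ 2 * r ^ 2 * b * ∑ i, ‖m i‖ ^ 2) := by
  have ha0 : 0 ≤ a := by linarith
  set T := ∑ i, ‖m i‖ ^ 2 with hT
  have hT0 : 0 ≤ T := Finset.sum_nonneg fun _ _ => by positivity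
  have hz : 0 ≤ |r| * b * a := by positivity
  have h1 := lintegral_ennexp_diagonal_le ha0 hν (norm_sq_le_of_norm_sq_sum_le hb) (r := 2 * r)
    (by rw [abs_mul, abs_two]; nlinarith)
  -- The factor 24 in `hr` is used here: `512 ≤ 24 ^ 2`.
  have h2 := lintegral_ennexp_offDiagonal_le ha0 hν hb0 hb (r := 2 * r) (by
    have : 8 * a * (a * (4 * (2 * r)) ^ 2 * b) * b = 512 * (|r| * b * a) ^ 2 := by
      rw [mul_pow _ a, mul_pow |r|, sq_abs]; ring
    nlinarith)
  rw [← hT] at h1 h2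
  rw [← ENNReal.mul_le_mul_iff_right (a := 2) (by simp) (by simp)]
  calc 2 * ∫⁻ x, ennexp (r * (‖∑ i, x i • m i‖ ^ 2 - T)) ∂Measure.pi ν
      = ∫⁻ x, 2 * ennexp (r * (‖∑ i, x i • m i‖ ^ 2 - T)) ∂Measure.pi ν :=
        (lintegral_const_mul' _ _ (by simp)).symm
    _ ≤ ∫⁻ x, (ennexp (2 * r * (∑ i, ‖x i • m i‖ ^ 2 - T)) +
          ennexp (2 * r * (‖∑ i, x i • m i‖ ^ 2 - ∑ i, ‖x i • m i‖ ^ 2))) ∂Measure.pi ν := by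
        refine lintegral_mono fun x => ?_
        refine le_trans (le_of_eq ?_) ((two_mul_ennexp_add_le
          (r * (∑ i, ‖x i • m i‖ ^ 2 - T))
          (r * (‖∑ i, x i • m i‖ ^ 2 - ∑ i, ‖x i • m i‖ ^ 2))).trans (le_of_eq ?_))
        · congr 2; ring
        · rw [mul_assoc, mul_assoc]
    _ = _ := lintegral_add_left (Continuous.measurable (by fun_prop)) _
    _ ≤ ennexp (256 * a ^ 2 * r ^ 2 * b * T) + ennexp (256 * a ^ 2 * r ^ 2 * b * T) := by
        refine add_le_add (h1.trans (ennexp_mono ?_)) (h2.trans (ennexp_mono ?_))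
        · have : a * (2 * r) ^ 2 = 4 * a * r ^ 2 := by ring
          have h4 : 4 * a ≤ 256 * a ^ 2 := by nlinarith
          rw [this]
          gcongr ?_ * r ^ 2 * b * T
        · refine (le_of_eq ?_); ring
    _ = _ := (two_mul _).symm

end HansonWright

/-! ### Tensors: flattening, contraction and induction on the order -/

lemma sum_fin_succ_arrow {n d : ℕ} {A : Type*} [AddCommMonoid A] (f : (Fin (d + 1) → Fin n) → A) :
    ∑ I, f I = ∑ J : Fin d → Fin n, ∑ i : Fin n, f (Fin.cons i J) := by
  rw [← (Fin.consEquiv fun _ => Fin n).sum_comp, Fintype.sum_prod_type_right]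
  rfl

/-- The flattening of `m` along its first index. -/
noncomputable def flattening {H : Type*} {n d : ℕ} (m : (Fin (d + 1) → Fin n) → H) (i : Fin n) :
    PiLp 2 fun _ : Fin d → Fin n => H :=
  WithLp.toLp 2 fun J => m (Fin.cons i J)

lemma sum_norm_sq_flattening {H : Type*} [NormedAddCommGroup H] {n d : ℕ}
    (m : (Fin (d + 1) → Fin n) → H) :
    ∑ i, ‖flattening m i‖ ^ 2 = ∑ I, ‖m I‖ ^ 2 := by
  rw [sum_fin_succ_arrow, Finset.sum_comm]
  refine Finset.sum_congr rfl fun i _ => ?_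
  rw [PiLp.norm_sq_eq_of_L2]
  simp [flattening]

section Tensor

variable {H : Type*} [NormedAddCommGroup H] [InnerProductSpace ℝ H] {n : ℕ}

/-- The value at `x₁ ⊗ ⋯ ⊗ x_d` of the linear map sending the basis tensor `I` to `m I`. -/
noncomputable def tensorEval {d : ℕ} (m : (Fin d → Fin n) → H) (x : Fin d → Fin n → ℝ) : H :=
  ∑ I, (∏ j, x j (I j)) • m I

@[fun_prop]
lemma continuous_tensorEval {d : ℕ} (m : (Fin d → Fin n) → H) : Continuous (tensorEval m) := by
  unfold tensorEval; fun_prop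

lemma tensorEval_cons {d : ℕ} (m : (Fin (d + 1) → Fin n) → H) (x : Fin n → ℝ)
    (y : Fin d → Fin n → ℝ) :
    tensorEval m (Fin.cons x y : Fin (d + 1) → Fin n → ℝ)
      = tensorEval (fun J => ∑ i, x i • m (Fin.cons i J)) y := by
  unfold tensorEval
  rw [sum_fin_succ_arrow]
  refine Finset.sum_congr rfl fun J _ => ?_
  rw [Finset.smul_sum]
  refine Finset.sum_congr rfl fun i _ => ?_
  rw [Fin.prod_univ_succ, smul_smul]
  simp [mul_comm]

lemma norm_sq_sum_flattening {d : ℕ} (m : (Fin (d + 1) → Fin n) → H) (x : Fin n → ℝ) :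
    ‖∑ i, x i • flattening m i‖ ^ 2 = ∑ J, ‖∑ i, x i • m (Fin.cons i J)‖ ^ 2 := by
  rw [PiLp.norm_sq_eq_of_L2]
  simp [flattening]

/-- Apply `hm` to the tensor `x ⊗ Y`. -/
lemma norm_sq_sum_contraction_le {d : ℕ} {m : (Fin (d + 1) → Fin n) → H} {b : ℝ}
    (hm : ∀ X : (Fin (d + 1) → Fin n) → ℝ, ‖∑ I, X I • m I‖ ^ 2 ≤ b * ∑ I, X I ^ 2)
    (x : Fin n → ℝ) (Y : (Fin d → Fin n) → ℝ) :
    ‖∑ J, Y J • ∑ i, x i • m (Fin.cons i J)‖ ^ 2 ≤ b * ((∑ i, x i ^ 2) * ∑ J, Y J ^ 2) := by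
  have h := hm fun I => x (I 0) * Y (Fin.tail I)
  rw [sum_fin_succ_arrow, sum_fin_succ_arrow] at h
  simp only [Fin.cons_zero, Fin.tail_cons] at h
  convert h using 3
  · refine Finset.sum_congr rfl fun J _ => ?_
    rw [Finset.smul_sum]
    exact Finset.sum_congr rfl fun i _ => by rw [smul_smul, mul_comm]
  · rw [Finset.mul_sum]
    refine Finset.sum_congr rfl fun J _ => ?_
    rw [Finset.sum_mul]
    exact Finset.sum_congr rfl fun i _ => by ring

/-- Each of the `n ^ d` slices is a contraction tested on a basis tensor. This count is the source
of the power of `n` in the final exponent. -/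
lemma norm_sq_sum_flattening_le {d : ℕ} {m : (Fin (d + 1) → Fin n) → H} {b : ℝ}
    (hm : ∀ X : (Fin (d + 1) → Fin n) → ℝ, ‖∑ I, X I • m I‖ ^ 2 ≤ b * ∑ I, X I ^ 2)
    (x : Fin n → ℝ) :
    ‖∑ i, x i • flattening m i‖ ^ 2 ≤ (n : ℝ) ^ d * b * ∑ i, x i ^ 2 := by
  classical
  rw [norm_sq_sum_flattening]
  have h : ∀ J : Fin d → Fin n, ‖∑ i, x i • m (Fin.cons i J)‖ ^ 2 ≤ b * ∑ i, x i ^ 2 := by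
    intro J
    simpa [Pi.single_apply] using norm_sq_sum_contraction_le hm x (Pi.single J 1)
  refine (Finset.sum_le_sum fun J _ => h J).trans (le_of_eq ?_)
  simp [mul_assoc]

/-- The quadratic bound for the identity scaled by `1 / √n`, where `b = 1 / n` and the trace is 1.
-/
lemma lintegral_ennexp_sum_sq_le (hn : 0 < n) {a : ℝ} (ha : 1 ≤ a) {ν : Fin n → Measure ℝ}
    [∀ i, IsProbabilityMeasure (ν i)] (hν : ∀ i, HasExpMomentBounds a (ν i)) {η : ℝ} (hη : 0 ≤ η)
    (hηa : η * (1 / n) * (24 * a) ≤ 1) :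
    ∫⁻ x, ennexp (η * ((∑ i, x i ^ 2) / n - 1)) ∂Measure.pi ν
      ≤ ennexp (256 * a ^ 2 * η ^ 2 * (1 / n)) := by
  have hn' : (0 : ℝ) < n := by exact_mod_cast hn
  set m : Fin n → EuclideanSpace ℝ (Fin n) := fun i => (√n)⁻¹ • EuclideanSpace.single i 1 with hmdef
  have hm : ∀ x : Fin n → ℝ, ‖∑ i, x i • m i‖ ^ 2 = 1 / n * ∑ i, x i ^ 2 := by
    intro x
    rw [EuclideanSpace.norm_sq_eq]
    simp [hmdef, Pi.single_apply, mul_pow, inv_pow, Real.sq_sqrt hn'.le]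
    rw [← Finset.sum_mul, mul_comm]
  have hT : ∑ i, ‖m i‖ ^ 2 = 1 := by
    simp [hmdef, norm_smul, inv_pow, Real.sq_sqrt hn'.le, hn'.ne']
  have h := lintegral_ennexp_quadratic_le ha hν (m := m) (b := 1 / n) (by positivity)
    (fun x => (hm x).le) (r := η) (by rwa [abs_of_nonneg hη])
  simp only [hm, hT, mul_one] at h
  convert h using 5
  ring

lemma one_le_add_of_le_abs {l u T k D : ℝ} (hl : 0 ≤ l) (hD : 0 ≤ D) (h : u ≤ |T - k|) :
    1 ≤ ennexp (-l * u + l * (T - k) + D) + ennexp (-l * u - l * (T - k) + D) := by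
  rcases le_abs.1 h with h | h
  · exact (one_le_ennexp (by nlinarith)).trans le_self_add
  · exact (one_le_ennexp (by nlinarith)).trans le_add_self

/-- Exponential tail bound for the squared norm of a linear map at a random simple tensor. Here
`l`, `η` are free parameters and `N` measures how large the norm of the linear map is. -/
theorem pi_tensorEval_tail_le (hn : 0 < n) {a R k u l η : ℝ} (ha : 1 ≤ a) (hR : 0 ≤ R) (hk : 0 ≤ k)
    (hu : u ≤ 2 * k) (hl : 0 ≤ l) (hη : 0 ≤ η) (hla : l * (3 * R) * (24 * a) ≤ 1)
    (hηa : η * (1 / n) * (24 * a) ≤ 1) (d : ℕ) (ν : Fin d → Fin n → Measure ℝ)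
    [∀ j i, IsProbabilityMeasure (ν j i)] (hν : ∀ j i, HasExpMomentBounds a (ν j i))
    (m : (Fin d → Fin n) → H) (N : ℝ)
    (hm : ∀ X : (Fin d → Fin n) → ℝ,
      ‖∑ I, X I • m I‖ ^ 2 ≤ Real.exp N * (R * n / (n : ℝ) ^ d) * ∑ I, X I ^ 2) :
    Measure.pi (fun j => Measure.pi (ν j)) {x | u ≤ |‖tensorEval m x‖ ^ 2 - k|} ≤
      ennexp (-l * u + l * (∑ I, ‖m I‖ ^ 2 - k) + d * (256 * a ^ 2 * l ^ 2 * (3 * R) * (3 * k))) +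
      ennexp (-l * u - l * (∑ I, ‖m I‖ ^ 2 - k) + d * (256 * a ^ 2 * l ^ 2 * (3 * R) * (3 * k))) +
      ennexp (η * (N - 1) + d * (256 * a ^ 2 * η ^ 2 * (1 / n))) := by
  have hn' : (0 : ℝ) < n := by exact_mod_cast hn
  have hα0 : 0 ≤ 256 * a ^ 2 * l ^ 2 * (3 * R) * (3 * k) := by positivity
  have hγ0 : 0 ≤ 256 * a ^ 2 * η ^ 2 * (1 / n) := by positivity
  set α := 256 * a ^ 2 * l ^ 2 * (3 * R) * (3 * k) with hα
  set γ := 256 * a ^ 2 * η ^ 2 * (1 / n) with hγ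
  induction d generalizing N with
  | zero =>
    have hT : ∀ x : Fin 0 → Fin n → ℝ, ‖tensorEval m x‖ ^ 2 = ∑ I, ‖m I‖ ^ 2 := by
      intro x; simp [tensorEval]
    simp only [hT]
    by_cases h : u ≤ |∑ I, ‖m I‖ ^ 2 - k|
    · exact prob_le_one.trans ((one_le_add_of_le_abs hl (by positivity) h).trans le_self_add)
    · simp only [h, Set.ofPred_false, measure_empty, zero_le]
  | succ d ih =>
    set T := ∑ I, ‖m I‖ ^ 2 with hT
    -- Outside the two trivial cases, `T < k + u ≤ 3 * k` and `exp N ≤ 3`, which are the bounds that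
    -- Hanson–Wright needs.
    by_cases h1 : u ≤ |T - k|
    · exact prob_le_one.trans ((one_le_add_of_le_abs hl (by positivity) h1).trans le_self_add)
    by_cases h2 : 1 ≤ N
    · have hN : 0 ≤ η * (N - 1) := mul_nonneg hη (by linarith)
      exact prob_le_one.trans ((one_le_ennexp (by positivity)).trans le_add_self)
    push Not at h1 h2
    have hTk : T ≤ 3 * k := by linarith [(abs_lt.1 h1).2]
    have hT0 : 0 ≤ T := Finset.sum_nonneg fun _ _ => by positivity
    have hexpN : Real.exp N ≤ 3 :=
      (Real.exp_le_exp.2 h2.le).trans (by linarith [Real.exp_one_lt_d9])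
    set S := {x : Fin (d + 1) → Fin n → ℝ | u ≤ |‖tensorEval m x‖ ^ 2 - k|} with hS
    have hSm : MeasurableSet S :=
      (isClosed_le continuous_const (by fun_prop)).measurableSet
    have hflat : ∀ x : Fin n → ℝ,
        ‖∑ i, x i • flattening m i‖ ^ 2 ≤ (3 * R) * ∑ i, x i ^ 2 := by
      intro x
      refine (norm_sq_sum_flattening_le hm x).trans ?_
      refine mul_le_mul_of_nonneg_right ?_ (by positivity)
      calc (n : ℝ) ^ d * (Real.exp N * (R * n / (n : ℝ) ^ (d + 1))) = Real.exp N * R := by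
            rw [pow_succ]; field_simp
        _ ≤ 3 * R := by gcongr
    have hquad : ∀ r : ℝ, |r| = l →
        ∫⁻ x, ennexp (r * (∑ J, ‖∑ i, x i • m (Fin.cons i J)‖ ^ 2 - T)) ∂Measure.pi (ν 0)
          ≤ ennexp α := by
      intro r hr
      have h := lintegral_ennexp_quadratic_le ha (hν 0) (by positivity) hflat (r := r)
        (by rwa [hr])
      simp only [norm_sq_sum_flattening, sum_norm_sq_flattening] at h
      refine h.trans (ennexp_mono ?_)
      rw [hα, ← hr, sq_abs]
      gcongr
    have hsq := lintegral_ennexp_sum_sq_le hn ha (hν 0) hη hηa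
    rw [← hγ] at hsq
    -- The induction hypothesis for the map contracted with `x`, its exponents split into the value
    -- before contraction and the increment due to `x`.
    have hcond : ∀ x : Fin n → ℝ,
        Measure.pi (fun j : Fin d => Measure.pi (ν j.succ))
          {y | (Fin.cons x y : Fin (d + 1) → Fin n → ℝ) ∈ S} ≤
        ennexp (-l * u + l * (T - k) + d * α) *
            ennexp (l * (∑ J, ‖∑ i, x i • m (Fin.cons i J)‖ ^ 2 - T)) +
          ennexp (-l * u - l * (T - k) + d * α) *
            ennexp (-l * (∑ J, ‖∑ i, x i • m (Fin.cons i J)‖ ^ 2 - T)) +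
          ennexp (η * (N - 1) + d * γ) * ennexp (η * ((∑ i, x i ^ 2) / n - 1)) := by
      intro x
      simp only [hS, Set.mem_ofPred_eq, tensorEval_cons]
      refine (ih (fun j => ν j.succ) (fun j => hν j.succ)
        (fun J => ∑ i, x i • m (Fin.cons i J)) (N + ((∑ i, x i ^ 2) / n - 1)) ?_).trans
        (le_of_eq ?_)
      · intro Y
        refine (norm_sq_sum_contraction_le hm x Y).trans ?_
        have h3 := Real.add_one_le_exp ((∑ i, x i ^ 2) / n - 1)
        rw [sub_add_cancel] at h3
        calc Real.exp N * (R * n / (n : ℝ) ^ (d + 1)) * ((∑ i, x i ^ 2) * ∑ J, Y J ^ 2)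
            = Real.exp N * (R * n / (n : ℝ) ^ d) * ((∑ i, x i ^ 2) / n) * ∑ J, Y J ^ 2 := by
              rw [pow_succ]; field_simp
          _ ≤ Real.exp N * (R * n / (n : ℝ) ^ d) * Real.exp ((∑ i, x i ^ 2) / n - 1)
                * ∑ J, Y J ^ 2 := by gcongr
          _ = _ := by rw [Real.exp_add]; ring
      · rw [← ennexp_add, ← ennexp_add, ← ennexp_add]
        congr 2
        · congr 1; ring
        · congr 1; ring
        · ring
    -- Fubini: condition on the first factor.
    have hprod : Measure.pi (fun j => Measure.pi (ν j)) S =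
        ∫⁻ x, Measure.pi (fun j : Fin d => Measure.pi (ν j.succ))
          {y | (Fin.cons x y : Fin (d + 1) → Fin n → ℝ) ∈ S} ∂Measure.pi (ν 0) := by
      have hmp := (measurePreserving_piFinSuccAbove (fun j => Measure.pi (ν j)) 0).symm
      rw [← hmp.measure_preimage hSm.nullMeasurableSet,
        Measure.prod_apply (hmp.measurable hSm)]
      simp only [Fin.succAbove_zero]
      refine lintegral_congr fun x => congrArg _ (Set.ext fun y => ?_)
      change (Fin.insertNth 0 x y : Fin (d + 1) → Fin n → ℝ) ∈ S ↔ _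
      rw [Fin.insertNth_zero']
      rfl
    rw [hprod]
    refine (lintegral_mono hcond).trans ?_
    rw [lintegral_add_right _ (Continuous.measurable (by fun_prop)
        |>.const_mul _), lintegral_add_right _ (Continuous.measurable (by fun_prop)
        |>.const_mul _), lintegral_const_mul' _ _ (ennexp_ne_top _),
      lintegral_const_mul' _ _ (ennexp_ne_top _), lintegral_const_mul' _ _ (ennexp_ne_top _)]
    have hsplit : ∀ p q : ℝ, ennexp (p + ((d + 1 : ℕ) : ℝ) * q) = ennexp (p + d * q) * ennexp q := by
      intro p q
      rw [← ennexp_add]; push_cast; congr 1; ring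
    rw [hsplit, hsplit, hsplit]
    gcongr
    · exact hquad l (abs_of_nonneg hl)
    · exact hquad (-l) (by rw [abs_neg, abs_of_nonneg hl])

end Tensor

/-! ### From the subgaussian norm to moment bounds -/

lemma HasExpMomentBounds.of_psiTwoNorm_le {Ω : Type*} [MeasurableSpace Ω] {μ : Measure Ω}
    [IsProbabilityMeasure μ] {ξ : Ω → ℝ} (hξ : Measurable ξ) (h1 : ∫ ω, ξ ω ∂μ = 0)
    (h2 : variance ξ μ = 1) {K : ℝ≥0} (hK : psiTwoNorm ξ μ ≤ K) :
    HasExpMomentBounds (48 * ((K : ℝ) + 1) ^ 4) (μ.map ξ) := by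
  have : IsProbabilityMeasure (μ.map ξ) := Measure.isProbabilityMeasure_map hξ.aemeasurable
  -- The infimum need not be known to be attained: the slack in `K + 1` yields an admissible `s < K
  -- + 1`, and it also makes the parameter at least 1.
  have hlt : psiTwoNorm ξ μ < ENNReal.ofReal ((K : ℝ) + 1) := by
    refine hK.trans_lt ?_
    rw [← ENNReal.ofReal_coe_nnreal]
    exact (ENNReal.ofReal_lt_ofReal_iff (by positivity)).2 (by linarith)
  simp only [psiTwoNorm, iInf_lt_iff] at hlt
  obtain ⟨s, hs0, hs, hsK⟩ := hlt
  have hsK' : s < K + 1 := (ENNReal.ofReal_lt_ofReal_iff (by positivity)).1 hsK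
  refine HasExpMomentBounds.of_integral (by linarith [K.coe_nonneg]) ?_ ?_ ?_
  · rw [integral_map hξ.aemeasurable (by fun_prop), h1]
  · rw [integral_map hξ.aemeasurable (by fun_prop), ← h2, variance_eq_integral hξ.aemeasurable, h1]
    simp
  · rw [lintegral_map (by fun_prop) hξ]
    refine le_trans (lintegral_mono fun ω => ?_) hs
    gcongr

/-! ### Distance to a subspace as a projection norm -/

section Projection

variable {ι : Type*} [Fintype ι]

/-- Both sides are the trace of the projection, which is idempotent and self-adjoint. -/
lemma sum_norm_sq_starProjection_single [DecidableEq ι]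
    (U : Submodule ℝ (EuclideanSpace ℝ ι)) :
    ∑ i, ‖U.starProjection (EuclideanSpace.single i 1)‖ ^ 2 = Module.finrank ℝ U := by
  have hproj : LinearMap.IsProj U (U.starProjection : EuclideanSpace ℝ ι →ₗ[ℝ] _) :=
    ⟨fun v => Submodule.starProjection_apply_mem U v,
      fun v hv => Submodule.starProjection_eq_self_iff.2 hv⟩
  rw [← hproj.trace, LinearMap.trace_eq_sum_inner _ (EuclideanSpace.basisFun ι ℝ)]
  refine Finset.sum_congr rfl fun i _ => ?_
  rw [EuclideanSpace.basisFun_apply, ← real_inner_self_eq_norm_sq,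
    Submodule.inner_starProjection_left_eq_right,
    Submodule.starProjection_eq_self_iff.2 (Submodule.starProjection_apply_mem U _)]
  rfl

lemma sum_smul_starProjection_single [DecidableEq ι]
    (U : Submodule ℝ (EuclideanSpace ℝ ι)) (X : ι → ℝ) :
    ∑ i, X i • U.starProjection (EuclideanSpace.single i 1)
      = U.starProjection (WithLp.toLp 2 X) := by
  have h := (EuclideanSpace.basisFun ι ℝ).sum_repr (WithLp.toLp 2 X)
  conv_rhs => rw [← h]
  simp

lemma infDist_eq_norm_starProjection_orthogonal (L : Submodule ℝ (EuclideanSpace ℝ ι))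
    (X : EuclideanSpace ℝ ι) :
    Metric.infDist X (L : Set (EuclideanSpace ℝ ι)) = ‖Lᗮ.starProjection X‖ := by
  rw [Submodule.starProjection_orthogonal_val, Submodule.starProjection_minimal,
    Metric.infDist_eq_iInf]
  simp only [dist_eq_norm]
  rfl

lemma finrank_quotient_eq_finrank_orthogonal (L : Submodule ℝ (EuclideanSpace ℝ ι)) :
    Module.finrank ℝ (EuclideanSpace ℝ ι ⧸ L) = Module.finrank ℝ Lᗮ := by
  have h1 := L.finrank_add_finrank_orthogonal
  have h2 := L.finrank_quotient_add_finrank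
  omega

end Projection

lemma map_eq_pi_pi {n d : ℕ} {Ω : Type*} [MeasurableSpace Ω] {μ : Measure Ω}
    [IsProbabilityMeasure μ] {x : Fin d → Ω → EuclideanSpace ℝ (Fin n)}
    (hx : ∀ k, Measurable (x k)) (hind : iIndepFun x μ)
    (hcoord : ∀ k, iIndepFun (fun (i : Fin n) (ω : Ω) => x k ω i) μ) :
    μ.map (fun ω k i => x k ω i)
      = Measure.pi fun k => Measure.pi fun i => μ.map fun ω => x k ω i := by
  have hm : ∀ k, Measurable fun ω (i : Fin n) => x k ω i := fun k => by fun_prop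
  have h1 : iIndepFun (fun k ω (i : Fin n) => x k ω i) μ :=
    hind.comp (fun _ v i => v i) fun _ => by fun_prop
  rw [(iIndepFun_iff_map_fun_eq_pi_map fun k => (hm k).aemeasurable).1 h1]
  congr 1
  ext1 k
  exact (iIndepFun_iff_map_fun_eq_pi_map fun i =>
    ((measurable_pi_apply i).comp (hm k)).aemeasurable).1 (hcoord k)

/-! ### Choice of parameters and conclusion -/

/-- Choice of the free parameters in `pi_tensorEval_tail_le`. -/
lemma exists_parameters {a k t R n d : ℝ} (ha : 48 ≤ a) (hk : 0 < k) (ht : 0 ≤ t)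
    (htk : t ≤ 2 * √k) (hR : 1 ≤ R) (hn : 0 < n) (hd : 1 ≤ d) (hkR : k ≤ R * n) :
    ∃ l η : ℝ, 0 ≤ l ∧ 0 ≤ η ∧ l * (3 * R) * (24 * a) ≤ 1 ∧ η * (1 / n) * (24 * a) ≤ 1 ∧
      -l * (t * √k) + d * (256 * a ^ 2 * l ^ 2 * (3 * R) * (3 * k))
        ≤ -(t ^ 2 / (36864 * a ^ 2 * (d * R))) ∧
      -η + d * (256 * a ^ 2 * η ^ 2 * (1 / n)) ≤ -(t ^ 2 / (36864 * a ^ 2 * (d * R))) := by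
  have hsk : 0 < √k := Real.sqrt_pos.2 hk
  have hsq : √k ^ 2 = k := Real.sq_sqrt hk.le
  have ht2 : t ^ 2 ≤ 4 * k := by nlinarith
  have ha0 : 0 < a := by linarith
  have hR0 : 0 < R := by linarith
  have hd0 : 0 < d := by linarith
  -- `l` minimizes the quadratic `-l * t * √k + 2304 * a ^ 2 * d * R * k * l ^ 2`. For `η` the order
  -- `n / (a ^ 2 * d)` is enough, since `t ^ 2 ≤ 4 * k ≤ 4 * R * n`.
  refine ⟨t / (4608 * a ^ 2 * d * R * √k), n / (4608 * a ^ 2 * d), by positivity, by positivity,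
    ?_, ?_, ?_, ?_⟩
  · have : t / (4608 * a ^ 2 * d * R * √k) * (3 * R) * (24 * a) = (t / √k) * (1 / (64 * a * d)) := by
      field_simp; ring
    rw [this]
    have h1 : t / √k ≤ 2 := by rw [div_le_iff₀ hsk]; exact htk
    have h2 : 1 / (64 * a * d) ≤ 1 / 2 := by
      apply one_div_le_one_div_of_le (by norm_num); nlinarith
    calc _ ≤ (2 : ℝ) * (1 / 2) := by gcongr
      _ = 1 := by norm_num
  · have : n / (4608 * a ^ 2 * d) * (1 / n) * (24 * a) = 1 / (192 * a * d) := by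
      field_simp; ring
    rw [this, div_le_one (by positivity)]
    nlinarith
  · have : -(t / (4608 * a ^ 2 * d * R * √k)) * (t * √k) + d * (256 * a ^ 2 *
        (t / (4608 * a ^ 2 * d * R * √k)) ^ 2 * (3 * R) * (3 * k))
        = -(t ^ 2 / (9216 * a ^ 2 * (d * R))) := by
      rw [div_pow, mul_pow, hsq]
      field_simp; ring
    rw [this]
    apply neg_le_neg
    gcongr
    norm_num
  · have : -(n / (4608 * a ^ 2 * d)) + d * (256 * a ^ 2 * (n / (4608 * a ^ 2 * d)) ^ 2 * (1 / n))
        ≤ -(4 * (R * n) / (36864 * a ^ 2 * (d * R))) := by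
      have e : -(n / (4608 * a ^ 2 * d)) + d * (256 * a ^ 2 * (n / (4608 * a ^ 2 * d)) ^ 2 * (1 / n))
        = -(17 * n / (82944 * a ^ 2 * d)) := by
        field_simp; ring
      have e2 : 4 * (R * n) / (36864 * a ^ 2 * (d * R)) = n / (9216 * a ^ 2 * d) := by
        field_simp; ring
      rw [e, e2]
      apply neg_le_neg
      rw [div_le_div_iff₀ (by positivity) (by positivity)]
      have : 0 < n * (a ^ 2 * d) := by positivity
      nlinarith
    refine this.trans (neg_le_neg ?_)
    gcongr
    linarith

/-- Trades a factor 4 in the exponent for the prefactor 2 instead of 3: if `exp (-z) ≥ 1 / 2`, the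
trivial bound `p ≤ 1` suffices. -/
lemma le_two_mul_exp_of_le_three_mul_exp {p z : ℝ} (h1 : p ≤ 1) (h3 : p ≤ 3 * Real.exp (-(4 * z))) :
    p ≤ 2 * Real.exp (-z) := by
  have e : Real.exp (-(4 * z)) = Real.exp (-z) ^ 4 := by
    rw [← Real.exp_nat_mul]; push_cast; ring_nf
  rw [e] at h3
  have h0 := Real.exp_pos (-z)
  set w := Real.exp (-z)
  rcases le_or_gt (1 / 2) w with hw | hw
  · linarith
  · have : w ^ 4 ≤ w * (1 / 2) ^ 3 := by
      rw [pow_succ' w 3]; gcongr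
    nlinarith

theorem corollary6p1 (K : ℝ≥0) :
    ∃ c : ℝ, 0 < c ∧
      ∀ (n d : ℕ), 0 < n → 0 < d →
      ∀ L : Submodule ℝ (EuclideanSpace ℝ (Fin d → Fin n)),
      ∀ (Ω : Type*) [MeasurableSpace Ω] (μ : Measure Ω) [IsProbabilityMeasure μ]
        (x : Fin d → Ω → EuclideanSpace ℝ (Fin n)),
        (∀ k, Measurable (x k)) →
        iIndepFun x μ →
        (∀ k, iIndepFun (fun (i : Fin n) (ω : Ω) => x k ω i) μ) →
        (∀ k i, ∫ ω, x k ω i ∂μ = 0) →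
        (∀ k i, variance (fun ω => x k ω i) μ = 1) →
        (∀ k i, psiTwoNorm (fun ω => x k ω i) μ ≤ K) →
        ∀ t : ℝ, 0 ≤ t →
          t ≤ 2 * √(Module.finrank ℝ (EuclideanSpace ℝ (Fin d → Fin n) ⧸ L) : ℝ) →
          μ.real {ω | t ≤ |Metric.infDist (simpleTensor fun k => x k ω) (L : Set _)
              - √(Module.finrank ℝ (EuclideanSpace ℝ (Fin d → Fin n) ⧸ L) : ℝ)|}
            ≤ 2 * Real.exp (-(c * t ^ 2 / ((d : ℝ) * (n : ℝ) ^ (d - 1)))) := by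
  set a : ℝ := 48 * ((K : ℝ) + 1) ^ 4 with ha_def
  have ha : 48 ≤ a := by
    have : 1 ≤ ((K : ℝ) + 1) ^ 4 := one_le_pow₀ (by linarith [K.coe_nonneg])
    linarith
  have ha0 : 0 < a := by linarith
  -- `147456 = 4 * 36864`: the constant from `exists_parameters`, with the factor 4 lost in passing
  -- to the prefactor 2.
  refine ⟨1 / (147456 * a ^ 2), by positivity, ?_⟩
  intro n d hn hd L Ω _ μ _ x hx hind hcoord hmean hvar hpsi t ht htk
  classical
  set k : ℝ := (Module.finrank ℝ (EuclideanSpace ℝ (Fin d → Fin n) ⧸ L) : ℝ) with hk_def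
  have hk0 : 0 ≤ k := by positivity
  rcases hk0.eq_or_lt with hk | hk
  · have ht0 : t = 0 := by
      rw [← hk] at htk
      simp only [Real.sqrt_zero, mul_zero] at htk
      exact le_antisymm htk ht
    refine measureReal_le_one.trans ?_
    simp [ht0]
  have hn' : (0 : ℝ) < n := by exact_mod_cast hn
  have hRn : (n : ℝ) ^ (d - 1) * n = (n : ℝ) ^ d := by
    rw [← pow_succ, Nat.sub_add_cancel hd]
  have hR : 1 ≤ (n : ℝ) ^ (d - 1) := one_le_pow₀ (by exact_mod_cast hn)
  have hd' : (1 : ℝ) ≤ d := by exact_mod_cast hd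
  have hkR : k ≤ (n : ℝ) ^ (d - 1) * n := by
    have h := Submodule.finrank_quotient_le L
    rw [finrank_euclideanSpace, Fintype.card_fun, Fintype.card_fin, Fintype.card_fin] at h
    rw [hRn, hk_def]
    exact_mod_cast h
  obtain ⟨l, η, hl, hη, hla, hηa, hl_le, hη_le⟩ := exists_parameters ha hk ht htk hR hn' hd' hkR
  set m : (Fin d → Fin n) → EuclideanSpace ℝ (Fin d → Fin n) :=
    fun I => Lᗮ.starProjection (EuclideanSpace.single I 1) with hm_def
  have hT : ∑ I, ‖m I‖ ^ 2 = k := by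
    rw [sum_norm_sq_starProjection_single, hk_def, finrank_quotient_eq_finrank_orthogonal]
  have hmb : ∀ X : (Fin d → Fin n) → ℝ, ‖∑ I, X I • m I‖ ^ 2 ≤
      Real.exp 0 * ((n : ℝ) ^ (d - 1) * n / (n : ℝ) ^ d) * ∑ I, X I ^ 2 := by
    intro X
    rw [hRn, div_self (by positivity), Real.exp_zero, one_mul, one_mul,
      sum_smul_starProjection_single]
    calc _ ≤ ‖(WithLp.toLp 2 X : EuclideanSpace ℝ (Fin d → Fin n))‖ ^ 2 := by
          gcongr
          exact Submodule.norm_starProjection_apply_le _ _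
      _ = _ := by rw [EuclideanSpace.norm_sq_eq]; simp
  have hmeas : ∀ j i, Measurable fun ω => x j ω i := fun j i => by fun_prop
  have hprob : ∀ j i, IsProbabilityMeasure (μ.map fun ω => x j ω i) :=
    fun j i => Measure.isProbabilityMeasure_map (hmeas j i).aemeasurable
  have hν : ∀ j i, HasExpMomentBounds a (μ.map fun ω => x j ω i) := fun j i =>
    .of_psiTwoNorm_le (hmeas j i) (hmean j i) (hvar j i) (hpsi j i)
  -- Start of the induction: `R = n ^ (d - 1)` and `N = 0` encode operator norm at most 1, and `t ≤
  -- 2 * √k` gives `u ≤ 2 * k`.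
  have htail := pi_tensorEval_tail_le hn (a := a) (R := (n : ℝ) ^ (d - 1)) (k := k)
    (u := t * √k) (by linarith) (by positivity) hk0
    (by nlinarith [Real.sq_sqrt hk0, Real.sqrt_nonneg k]) hl hη hla hηa d
    (fun j i => μ.map fun ω => x j ω i) hν m 0 hmb
  rw [hT, ← map_eq_pi_pi hx hind hcoord, Measure.map_apply (by fun_prop)
    (isClosed_le continuous_const (by fun_prop)).measurableSet] at htail
  simp only [sub_self, mul_zero, add_zero, sub_zero, zero_sub, mul_neg, mul_one] at htail
  set z := 1 / (147456 * a ^ 2) * t ^ 2 / (d * (n : ℝ) ^ (d - 1)) with hz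
  have h4z : t ^ 2 / (36864 * a ^ 2 * (d * (n : ℝ) ^ (d - 1))) = 4 * z := by
    rw [hz]; field_simp; ring
  rw [h4z] at hl_le hη_le
  refine le_two_mul_exp_of_le_three_mul_exp measureReal_le_one
    (ENNReal.toReal_le_of_le_ofReal (by positivity) ?_)
  refine le_trans (measure_mono fun ω hω => ?_) (htail.trans ?_)
  · have hval : tensorEval m (fun j i => x j ω i)
        = Lᗮ.starProjection (simpleTensor fun k => x k ω) :=
      sum_smul_starProjection_single _ _
    simp only [Set.mem_ofPred_eq, infDist_eq_norm_starProjection_orthogonal] at hω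
    simp only [Set.mem_preimage, Set.mem_ofPred_eq, hval]
    set r := ‖Lᗮ.starProjection (simpleTensor fun k => x k ω)‖
    -- Since `r + √k ≥ √k`, a deviation `t` of the distance forces a deviation `t * √k` of its
    -- square.
    have hr : r ^ 2 - k = (r - √k) * (r + √k) := by
      linear_combination Real.sq_sqrt hk0
    rw [hr, abs_mul]
    have h1 : √k ≤ |r + √k| := (le_add_of_nonneg_left (norm_nonneg _)).trans (le_abs_self _)
    gcongr
  · have h := ennexp_mono hl_le
    have h' := ennexp_mono hη_le
    have e : ENNReal.ofReal (3 * Real.exp (-(4 * z))) =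
        ennexp (-(4 * z)) + ennexp (-(4 * z)) + ennexp (-(4 * z)) := by
      simp only [ennexp]
      rw [← ENNReal.ofReal_add (by positivity) (by positivity),
        ← ENNReal.ofReal_add (by positivity) (by positivity)]
      ring_nf
    rw [e]
    gcongr
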